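/- Let $H$ be a Hilbert space over $\mathbb K=\mathbb R$ or $\mathbb C$, let $T:H\to H$ be a compact linear operator, and let $\mu\neq 0$ be an eigenvalue of $T$ with eigenspace $M(\mu)=\{u\in H: Tu=\mu u\}$ and algebraic multiplicity $m$. For subspaces $M,N\subset H$ put $\delta(M,N)=\sup_{x\in M,\|x\|=1}\operatorname{dist}(x,N)$, and for unit vectors $\varphi_1,\dots,\varphi_n$ put $$\theta(\varphi_1,\dots,\varphi_n)=\inf_{\alpha\in\mathbb K^n,\ \alpha\ne0}\frac{\|\sum_i\alpha_i\varphi_i\|^2}{\sum_i\|\alpha_i\varphi_i\|^2}.$$ *Multi-level algorithm for $k$ eigenvalues of $T$.* Given are nested subspaces $G_0\subset G_1\subset\dots\subset G_N\subset H$ and bounded linear projections $P_i$ of $H$ onto $G_i$ ($1\le i\le N$); set $\widetilde G_0=G_0$. For $i=0,\dots,N$, choose a bounded linear projection $\widetilde P_i$ of $H$ onto $\widetilde G_i$ and compute the first $k$ (modulus-biggest, counted with multiplicity) eigenpairs $(\tilde\mu_j^i,\tilde u_j^i)_{1\le j\le k}$ of $\widetilde P_iT$, with $\tilde\mu^i_j\ne0$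 and linearly independent unit eigenvectors $\tilde u_j^i$; if $i<N$, set $\hat u_j^{i+1}=\frac1{\tilde\mu_j^i}P_{i+1}T\tilde u_j^i$ and $\widetilde G_{i+1}=G_0+\operatorname{span}\{\hat u_j^{i+1}\}_{j=1}^k$. **Theorem.** Let $C_0,\theta_0>0$. There are constants $\beta_1,\beta_2>0$, depending only on $T$, $\mu$, $C_0$ and $\theta_0$, such that for every $r>0$ for which the closed disc in $\mathbb K$ of radius $r$ about $\mu$ contains no point of the spectrum $\sigma(T)\subset\mathbb K$ other than $\mu$, there is $\varepsilon>0$ (depending only on $T,\mu,C_0,\theta_0,r$) with the following property. Consider any run of the algorithm (any $N\ge0$ and $k$) such that 1. $G_0$ is big enough: $\operatorname{dist}(Tx,G_0)\le\varepsilon\|x\|$ for all $x\in H$; 2. the projections are quasi-optimal: $\displaystyle\inf_{u\in H\setminus G_l,\,v\in G_l}\frac{\|u-v\|}{\|u-P_lu\|}\ge C_0$ for $1\le l\le N$, and likewise for $\widetilde P_l$, $\widetilde G_l$ in place of $P_l$, $G_l$ for $0\le l\le N-1$; 3. at each level $0\le l\le N-1$, $m$ of the computed eigenpairs, relabelled $(\tilde\mu^l_j,\tilde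 u^l_j)_{1\le j\le m}$, approximate $\mu$ in the sense that $|\tilde\mu_j^l-\mu|<r$, and $\theta(\tilde u_1^l,\dots,\tilde u_m^l)\ge\theta_0$. Then $$\delta(M(\mu),\widetilde G_N)\le\beta_1\sum_{l=0}^N\Big[\prod_{j=l}^{N-1}\big(\beta_2\|T-T\widetilde P_j\|\big)\Big]\,\delta(M(\mu),G_l).$$ -/

import Mathlib

/-- `δ(M, N) = sup {dist(x, N) : x ∈ M, ‖x‖ = 1}`.  The supremum is over a set bounded by `1`,
since `dist(x, N) ≤ ‖x‖`. -/
noncomputable def oneSidedGap {𝕜 H : Type*} [RCLike 𝕜] [NormedAddCommGroup H]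
    [InnerProductSpace 𝕜 H] (M N : Submodule 𝕜 H) : ℝ :=
  sSup ((fun x : H => Metric.infDist x (N : Set H)) '' {x : H | x ∈ M ∧ ‖x‖ = 1})

/-- The stability constant `θ(φ₁, …, φₙ)` of unit vectors: the infimum over nonzero coefficient
vectors `α` of `‖∑ αᵢ φᵢ‖² / ∑ ‖αᵢ φᵢ‖²`.  The coefficients range over the scalar field of the
Hilbert space (`ℝ` for a real one). -/
noncomputable def stabilityConstant (𝕜 : Type*) {H : Type*} [RCLike 𝕜] [NormedAddCommGroup H]
    [InnerProductSpace 𝕜 H] {n : ℕ} (φ : Fin n → H) : ℝ :=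
  ⨅ α : {α : Fin n → 𝕜 // α ≠ 0},
    ‖∑ i, (α : Fin n → 𝕜) i • φ i‖ ^ 2 / ∑ i, ‖(α : Fin n → 𝕜) i • φ i‖ ^ 2

/-- `inf_{u ∈ H \ G, v ∈ G} ‖u - v‖ / ‖u - P u‖ ≥ C₀` (for a projection `P` onto `G`, where the
denominators do not vanish). -/
def IsQuasiOptimal {𝕜 H : Type*} [RCLike 𝕜] [NormedAddCommGroup H] [InnerProductSpace 𝕜 H]
    (C₀ : ℝ) (G : Submodule 𝕜 H) (P : H →L[𝕜] H) : Prop :=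
  ∀ u : H, u ∉ G → ∀ v ∈ G, C₀ ≤ ‖u - v‖ / ‖u - P u‖

/-- `(lam j, v j)`, `j = 1, …, k`, are `k` first (modulus-biggest, counted with multiplicity)
eigenpairs of `A`, with nonzero eigenvalues and linearly independent unit eigenvectors:
an eigenvalue of modulus bigger than some listed one has all its eigenvectors spanned by listed
ones. -/
structure IsFirstEigenpairs {𝕜 H : Type*} [RCLike 𝕜] [NormedAddCommGroup H]
    [InnerProductSpace 𝕜 H] (A : H →L[𝕜] H) {k : ℕ} (lam : Fin k → 𝕜) (v : Fin k → H) :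
    Prop where
  eigen : ∀ j, A (v j) = lam j • v j
  ne_zero : ∀ j, lam j ≠ 0
  norm_eq_one : ∀ j, ‖v j‖ = 1
  linearIndependent : LinearIndependent 𝕜 v
  biggest : ∀ (ν : 𝕜) (j : Fin k), ‖lam j‖ < ‖ν‖ →
    Module.End.eigenspace (A : H →ₗ[𝕜] H) ν ≤ Submodule.span 𝕜 (v '' {i | lam i = ν})

/-- The data `G i`, `P i`, `Gt i`, `Pt i`, `lam i j`, `v i j` form a run of the multi-level
algorithm for `k` eigenvalues of `T` with levels `0, …, N`:
* `G 0 ⊆ G 1 ⊆ ⋯ ⊆ G N`, and `P i` is a projection onto `G i` for `1 ≤ i ≤ N`;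
* `Pt i` is a projection onto the auxiliary space `Gt i`, and `(lam i j, v i j)` are the
  first `k` eigenpairs of `Pt i ∘ T`, for `0 ≤ i ≤ N`;
* `Gt 0 = G 0` and `Gt (i + 1) = G 0 + span {(lam i j)⁻¹ P (i + 1) T (v i j)}`.
Entries with an index above `N` play no role. -/
structure IsMultilevelRun {𝕜 H : Type*} [RCLike 𝕜] [NormedAddCommGroup H]
    [InnerProductSpace 𝕜 H] (T : H →L[𝕜] H) (N k : ℕ)
    (G : ℕ → Submodule 𝕜 H) (P : ℕ → H →L[𝕜] H)
    (Gt : ℕ → Submodule 𝕜 H) (Pt : ℕ → H →L[𝕜] H)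
    (lam : ℕ → Fin k → 𝕜) (v : ℕ → Fin k → H) : Prop where
  nested : ∀ i < N, G i ≤ G (i + 1)
  proj : ∀ i, 1 ≤ i → i ≤ N → LinearMap.IsProj (G i) (P i : H →ₗ[𝕜] H)
  aux_zero : Gt 0 = G 0
  aux_proj : ∀ i ≤ N, LinearMap.IsProj (Gt i) (Pt i : H →ₗ[𝕜] H)
  eigenpairs : ∀ i ≤ N, IsFirstEigenpairs (Pt i ∘L T) (lam i) (v i)
  aux_succ : ∀ i < N, Gt (i + 1) =
    G 0 ⊔ Submodule.span 𝕜 (Set.range fun j : Fin k => (lam i j)⁻¹ • P (i + 1) (T (v i j)))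

/-! Let `M ≤ E` be the eigenspace and the generalized eigenspace, and let `V` be the span of the `m`
selected eigenvectors of `A = Pt l ∘L T`. Since `A` is close to `T`, a resolvent bound on an annulus
forces their eigenvalues close to `μ`; with stability, `T - μ` is small on `V`, so `V` is close to
`M`. Hence `m = dim V ≤ dim M ≤ dim E = m`: one level of the algorithm already forces `μ` to be
semisimple, and `‖A x - μ x‖` controls the distance of `x` to `V` (`exists_mem_span_norm_sub_le`).

For a unit `u ∈ M` take `x = Pt u`. Idempotence of `Pt` gives `A x - μ x = -Pt (T - T Pt) (u - Pt
u)`, whence the factor `‖T - T Pt‖` times the gap at level `l`. So `u` is close to `μ⁻¹ T x'` for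
some `x' ∈ V`, and `P (l + 1)` carries this into `Gt (l + 1)`. The result is a linear recursion for
the gaps, solved by `le_mul_sum_prod_of_recursion`. -/

/-! ### Spectral theory of compact operators at a nonzero scalar -/

section CompactOperator

variable {𝕜 H : Type*} [RCLike 𝕜] [NormedAddCommGroup H] [InnerProductSpace 𝕜 H]
  {T : H →L[𝕜] H} {μ : 𝕜}

open Filter Topology Module Module.End

/-- Away from its eigenspace, a compact operator minus a nonzero scalar is bounded below. -/
theorem IsCompactOperator.exists_mul_norm_le_of_mem_orthogonal (hT : IsCompactOperator T)
    (hμ : μ ≠ 0) :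
    ∃ c > 0, ∀ y ∈ (eigenspace (T : H →ₗ[𝕜] H) μ)ᗮ, c * ‖y‖ ≤ ‖T y - μ • y‖ := by
  by_contra! h
  have h' (n : ℕ) : ∃ y ∈ (eigenspace (T : H →ₗ[𝕜] H) μ)ᗮ, ‖y‖ = 1 ∧
      ‖T y - μ • y‖ < 1 / ((n : ℝ) + 1) := by
    obtain ⟨y, hy, hlt⟩ := h (1 / ((n : ℝ) + 1)) (by positivity)
    have hy0 : 0 < ‖y‖ := by
      rw [norm_pos_iff]
      rintro rfl
      simp at hlt
    refine ⟨((‖y‖⁻¹ : ℝ) : 𝕜) • y, Submodule.smul_mem _ _ hy, ?_, ?_⟩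
    · rw [norm_smul]
      simp [hy0.ne']
    · rw [map_smul, smul_comm μ, ← smul_sub, norm_smul]
      simp only [RCLike.norm_ofReal, abs_inv, abs_norm]
      rw [inv_mul_lt_iff₀ hy0]
      linarith
  choose y hyM hy1 hylt using h'
  -- By compactness a subsequence of `y n` converges; its limit is a unit vector in both the
  -- eigenspace and its complement.
  obtain ⟨K, hK, hKT⟩ := hT.image_closedBall_subset_compact 1
  obtain ⟨z, -, ψ, hψ, hz⟩ := hK.tendsto_subseq (x := fun n => T (y n))
    (fun n => hKT ⟨y n, by simp [hy1], rfl⟩)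
  have hlim : Tendsto (fun n => T (y (ψ n)) - μ • y (ψ n)) atTop (𝓝 0) :=
    (squeeze_zero_norm (fun n => (hylt n).le) tendsto_one_div_add_atTop_nhds_zero_nat).comp
      hψ.tendsto_atTop
  have hy : Tendsto (fun n => y (ψ n)) atTop (𝓝 (μ⁻¹ • z)) := by
    have := (hz.sub hlim).const_smul μ⁻¹
    simpa [Function.comp_def, smul_smul, inv_mul_cancel₀ hμ] using this
  have hmem : μ⁻¹ • z ∈ (eigenspace (T : H →ₗ[𝕜] H) μ)ᗮ :=
    (Submodule.isClosed_orthogonal _).mem_of_tendsto hy (Eventually.of_forall fun n => hyM _)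
  have hmem' : μ⁻¹ • z ∈ eigenspace (T : H →ₗ[𝕜] H) μ := by
    rw [mem_eigenspace_iff, smul_smul, mul_inv_cancel₀ hμ, one_smul]
    exact tendsto_nhds_unique ((T.continuous.tendsto _).comp hy) hz
  have h0 : μ⁻¹ • z = 0 :=
    Submodule.disjoint_def.1 (Submodule.orthogonal_disjoint _) _ hmem' hmem
  have h1 := hy.norm
  simp only [hy1, h0, norm_zero] at h1
  exact one_ne_zero (tendsto_nhds_unique tendsto_const_nhds h1)

variable [CompleteSpace H]

/-- The generalized eigenspaces of a compact operator for a nonzero scalar are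
finite-dimensional. -/
theorem IsCompactOperator.finiteDimensional_genEigenspace (hT : IsCompactOperator T)
    (hμ : μ ≠ 0) (n : ℕ) :
    FiniteDimensional 𝕜 (genEigenspace (T : H →ₗ[𝕜] H) μ n) := by
  have h1 : FiniteDimensional 𝕜 (eigenspace (T : H →ₗ[𝕜] H) μ) :=
    ContinuousLinearMap.finite_dimensional_eigenspace hT μ hμ
  induction n with
  | zero =>
    have h : genEigenspace (T : H →ₗ[𝕜] H) μ (0 : ℕ) = ⊥ := by simp
    rw [h]
    infer_instance
  | succ n ih =>
    rw [← Submodule.fg_iff_finiteDimensional] at h1 ih ⊢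
    -- `T - μ` maps level `n + 1` into level `n`, and its kernel is the eigenspace.
    refine Submodule.fg_of_fg_map_of_fg_inf_ker ((T : H →ₗ[𝕜] H) - μ • 1) ?_ ?_
    · have : FiniteDimensional 𝕜 (genEigenspace (T : H →ₗ[𝕜] H) μ n) :=
        Submodule.fg_iff_finiteDimensional _ |>.1 ih
      refine (Submodule.fg_iff_finiteDimensional _).2
        (Submodule.finiteDimensional_of_le (S₂ := genEigenspace (T : H →ₗ[𝕜] H) μ n) ?_)
      rintro _ ⟨x, hx, rfl⟩
      rw [SetLike.mem_coe, mem_genEigenspace_nat, LinearMap.mem_ker, pow_succ] at hx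
      rw [mem_genEigenspace_nat, LinearMap.mem_ker]
      exact hx
    · have : FiniteDimensional 𝕜 (eigenspace (T : H →ₗ[𝕜] H) μ) :=
        Submodule.fg_iff_finiteDimensional _ |>.1 h1
      refine (Submodule.fg_iff_finiteDimensional _).2
        (Submodule.finiteDimensional_of_le (S₂ := eigenspace (T : H →ₗ[𝕜] H) μ) ?_)
      rw [eigenspace_def]
      exact inf_le_right

/-- The generalized eigenspaces of a compact operator for a nonzero scalar stabilize. -/
theorem IsCompactOperator.exists_genEigenspace_succ_eq (hT : IsCompactOperator T) (hμ : μ ≠ 0) :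
    ∃ n : ℕ, genEigenspace (T : H →ₗ[𝕜] H) μ (n + 1 : ℕ) =
      genEigenspace (T : H →ₗ[𝕜] H) μ n := by
  by_contra! hne
  set F : ℕ → Submodule 𝕜 H := fun n => genEigenspace (T : H →ₗ[𝕜] H) μ n with hF
  have hmono : Monotone F := fun a b hab =>
    (genEigenspace (T : H →ₗ[𝕜] H) μ).monotone (by exact_mod_cast hab)
  have hfin (n) : FiniteDimensional 𝕜 (F n) := hT.finiteDimensional_genEigenspace hμ n
  -- Riesz's argument: modulo `F n`, `T (x n)` equals `μ • x n`, so the images are `‖μ‖`-separated.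
  have hx (n : ℕ) : ∃ x ∈ F (n + 1), x ∈ (F n)ᗮ ∧ ‖x‖ = 1 := by
    have hbot : (F n)ᗮ ⊓ F (n + 1) ≠ ⊥ := by
      intro h0
      have := Submodule.sup_orthogonal_inf_of_hasOrthogonalProjection (hmono n.le_succ)
      rw [h0, sup_bot_eq] at this
      exact hne n this.symm
    obtain ⟨x, hx, hx0⟩ := Submodule.exists_mem_ne_zero_of_ne_bot hbot
    refine ⟨((‖x‖⁻¹ : ℝ) : 𝕜) • x, Submodule.smul_mem _ _ hx.2, Submodule.smul_mem _ _ hx.1, ?_⟩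
    rw [norm_smul]
    simp [hx0]
  choose x hxF hxo hx1 using hx
  have hL (n : ℕ) : T (x n) - μ • x n ∈ F n := by
    have := hxF n
    simp only [hF, mem_genEigenspace_nat, LinearMap.mem_ker, pow_succ] at this ⊢
    exact this
  have hTF (n : ℕ) : T (x n) ∈ F (n + 1) := by
    have := (F (n + 1)).add_mem (hmono n.le_succ (hL n)) ((F (n + 1)).smul_mem μ (hxF n))
    simpa using this
  have hsep (a b : ℕ) (hab : a < b) : ‖μ‖ ≤ ‖T (x b) - T (x a)‖ := by
    have hmem : T (x b) - μ • x b - T (x a) ∈ F b :=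
      (F b).sub_mem (hL b) (hmono hab (hTF a))
    have h0 : inner 𝕜 (x b) (T (x b) - μ • x b - T (x a)) = 0 :=
      Submodule.inner_left_of_mem_orthogonal hmem (hxo b)
    have hinner : inner 𝕜 (x b) (T (x b) - T (x a)) = μ := by
      have e : T (x b) - T (x a) = (T (x b) - μ • x b - T (x a)) + μ • x b := by abel
      rw [e, inner_add_right, h0, inner_smul_right, inner_self_eq_norm_sq_to_K, hx1]
      simp
    calc ‖μ‖ = ‖inner 𝕜 (x b) (T (x b) - T (x a))‖ := by rw [hinner]
      _ ≤ ‖x b‖ * ‖T (x b) - T (x a)‖ := norm_inner_le_norm _ _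
      _ = _ := by rw [hx1, one_mul]
  obtain ⟨K, hK, hKT⟩ := hT.image_closedBall_subset_compact 1
  obtain ⟨z, -, ψ, hψ, hz⟩ := hK.tendsto_subseq (x := fun n => T (x n))
    (fun n => hKT ⟨x n, by simp [hx1], rfl⟩)
  obtain ⟨N, hN⟩ := Metric.cauchySeq_iff'.1 hz.cauchySeq ‖μ‖ (norm_pos_iff.2 hμ)
  have := hN (N + 1) N.le_succ
  rw [dist_eq_norm] at this
  exact (hsep _ _ (hψ N.lt_succ_self)).not_gt this

/-- One equality in the chain propagates upwards, because `T - μ` lowers the level by one.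
Finiteness is what makes the `finrank` defining `m` a genuine multiplicity. -/
theorem IsCompactOperator.finiteDimensional_maxGenEigenspace (hT : IsCompactOperator T)
    (hμ : μ ≠ 0) : FiniteDimensional 𝕜 (maxGenEigenspace (T : H →ₗ[𝕜] H) μ) := by
  obtain ⟨n, hn⟩ := hT.exists_genEigenspace_succ_eq hμ
  have hstep (k : ℕ) : genEigenspace (T : H →ₗ[𝕜] H) μ (n + k : ℕ) ≤
      genEigenspace (T : H →ₗ[𝕜] H) μ n := by
    induction k with
    | zero => rfl
    | succ k ih =>
      intro x hx
      rw [← hn]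
      rw [mem_genEigenspace_nat, LinearMap.mem_ker, ← add_assoc, pow_succ] at hx
      rw [mem_genEigenspace_nat, LinearMap.mem_ker, pow_succ]
      have := ih (x := ((T : H →ₗ[𝕜] H) - μ • 1) x)
        (by rw [mem_genEigenspace_nat, LinearMap.mem_ker]; exact hx)
      rwa [mem_genEigenspace_nat, LinearMap.mem_ker] at this
  have hle : maxGenEigenspace (T : H →ₗ[𝕜] H) μ ≤ genEigenspace (T : H →ₗ[𝕜] H) μ n := by
    rw [maxGenEigenspace, genEigenspace_top]
    refine iSup_le fun k => le_trans ?_ (hstep k)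
    exact (genEigenspace (T : H →ₗ[𝕜] H) μ).monotone (by exact_mod_cast Nat.le_add_left k n)
  have := hT.finiteDimensional_genEigenspace hμ n
  exact Submodule.finiteDimensional_of_le hle

/-- If a nonzero eigenvalue of a compact operator is semisimple, then `T - μ` plus the orthogonal
projection onto the eigenspace is bounded below. -/
theorem IsCompactOperator.exists_mul_norm_le_add_starProjection (hT : IsCompactOperator T)
    (hμ : μ ≠ 0) [FiniteDimensional 𝕜 (eigenspace (T : H →ₗ[𝕜] H) μ)]
    (hss : eigenspace (T : H →ₗ[𝕜] H) μ = maxGenEigenspace (T : H →ₗ[𝕜] H) μ) :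
    ∃ c > 0, ∀ x, c * ‖x‖ ≤
      ‖T x - μ • x + (eigenspace (T : H →ₗ[𝕜] H) μ).starProjection x‖ := by
  set M := eigenspace (T : H →ₗ[𝕜] H) μ with hM
  have : ProperSpace M := FiniteDimensional.proper_rclike 𝕜 M
  have hQ : IsCompactOperator M.starProjection :=
    (isCompactOperator_of_locallyCompactSpace_rng M.subtypeL).comp_clm M.orthogonalProjectionOnto
  have hTQ : IsCompactOperator (T + M.starProjection) := hT.add hQ
  have hno : ¬ HasEigenvalue ((T + M.starProjection : H →L[𝕜] H) : End 𝕜 H) μ := by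
    intro h
    obtain ⟨x, hx, hx0⟩ := h.exists_hasEigenvector
    rw [mem_eigenspace_iff] at hx
    have hx' : T x + M.starProjection x = μ • x := hx
    have hLx : T x - μ • x = - M.starProjection x := by rw [← hx']; abel
    have hLM : T x - μ • x ∈ M := by
      rw [hLx]; exact M.neg_mem (M.starProjection_apply_mem x)
    -- Here `(T - μ)² x = 0`, and semisimplicity brings `x` down to `M`.
    have hxM : x ∈ M := by
      rw [hss, mem_maxGenEigenspace]
      refine ⟨2, ?_⟩
      rw [hM, eigenspace_def, LinearMap.mem_ker] at hLM
      rw [pow_two]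
      exact hLM
    have hTx : T x = μ • x := mem_eigenspace_iff.1 hxM
    rw [hTx, sub_self, Submodule.starProjection_eq_self_iff.2 hxM] at hLx
    exact hx0 (neg_eq_zero.1 hLx.symm)
  obtain ⟨c, hc, h⟩ := antilipschitzWith_iff_exists_mul_le_norm.1
    (hTQ.antilipschitz_of_not_hasEigenvalue hμ hno)
  refine ⟨c, hc, fun x => (h x).trans_eq ?_⟩
  congr 1
  simp only [sub_apply, add_apply, smul_apply, one_apply_eq_self]
  abel

/-- On a compact set disjoint from the spectrum, `T - z` is uniformly bounded below. -/
theorem ContinuousLinearMap.exists_mul_norm_le_of_isCompact (T : H →L[𝕜] H) {K : Set 𝕜}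
    (hK : IsCompact K) (hKT : ∀ z ∈ K, z ∉ spectrum 𝕜 T) :
    ∃ c > 0, ∀ z ∈ K, ∀ x, c * ‖x‖ ≤ ‖T x - z • x‖ := by
  have hres : ∀ z ∈ K, z ∈ resolventSet 𝕜 T := fun z hz => by
    simpa [spectrum] using hKT z hz
  obtain ⟨C, hC⟩ := hK.exists_bound_of_continuousOn (f := resolvent T) fun z hz =>
    (spectrum.hasDerivAt_resolvent_const_left (hres z hz)).continuousAt.continuousWithinAt
  refine ⟨(max C 1)⁻¹, by positivity, fun z hz x => ?_⟩
  rw [inv_mul_le_iff₀ (by positivity)]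
  have hinv : resolvent T z * (algebraMap 𝕜 (H →L[𝕜] H) z - T) = 1 :=
    Ring.inverse_mul_cancel _ (hres z hz)
  have hx : x = resolvent T z (z • x - T x) := by
    have := congrArg (fun A : H →L[𝕜] H => A x) hinv
    simpa [Algebra.algebraMap_eq_smul_one] using this.symm
  calc ‖x‖ = ‖resolvent T z (z • x - T x)‖ := by rw [← hx]
    _ ≤ ‖resolvent T z‖ * ‖z • x - T x‖ := ContinuousLinearMap.le_opNorm _ _
    _ ≤ max C 1 * ‖T x - z • x‖ := by
      rw [norm_sub_rev]
      gcongr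
      exact (hC z hz).trans (le_max_left _ _)

end CompactOperator

/-! ### Perturbation of an eigenspace and stable systems -/

section Perturbation

variable {𝕜 H : Type*} [RCLike 𝕜] [NormedAddCommGroup H] [InnerProductSpace 𝕜 H]

/-- A subspace on which `T - μ` is small is close to the eigenspace of `T`. -/
theorem norm_sub_starProjection_le {T : H →L[𝕜] H} {μ : 𝕜} {M V : Submodule 𝕜 H}
    [M.HasOrthogonalProjection] (hM : ∀ x ∈ M, T x = μ • x) {c κ : ℝ} (hc : 0 < c)
    (hcM : ∀ y ∈ Mᗮ, c * ‖y‖ ≤ ‖T y - μ • y‖) (hV : ∀ x ∈ V, ‖T x - μ • x‖ ≤ κ * ‖x‖)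
    {x : H} (hx : x ∈ V) : ‖x - M.starProjection x‖ ≤ κ / c * ‖x‖ := by
  have h1 := hcM _ (Submodule.sub_starProjection_mem_orthogonal (K := M) x)
  have h2 : T (x - M.starProjection x) - μ • (x - M.starProjection x) = T x - μ • x := by
    rw [map_sub, smul_sub, hM _ (M.starProjection_apply_mem x)]
    abel
  rw [h2] at h1
  rw [div_mul_eq_mul_div, le_div_iff₀ hc, mul_comm]
  exact h1.trans (hV x hx)

/-- If `V` is close to `M`, then the orthogonal projection of `V` to `M` is injective. -/
theorem injective_orthogonalProjectionOnto_comp_subtype {M V : Submodule 𝕜 H}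
    [M.HasOrthogonalProjection] {κ : ℝ} (hκ : κ < 1)
    (hV : ∀ x ∈ V, ‖x - M.starProjection x‖ ≤ κ * ‖x‖) :
    Function.Injective ((M.orthogonalProjectionOnto : H →ₗ[𝕜] M) ∘ₗ V.subtype) := by
  rw [injective_iff_map_eq_zero]
  rintro ⟨x, hx⟩ h
  have h0 : M.starProjection x = 0 := by
    rw [Submodule.starProjection_apply]
    exact congrArg Subtype.val h
  have h1 := hV x hx
  rw [h0, sub_zero] at h1
  have : ‖x‖ = 0 := by nlinarith [norm_nonneg x]
  simpa using this

/-- If `A` is close to `T`, and `V` is an invariant subspace of `A` close to the eigenspace `M` of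
`T`, then `‖A x - μ x‖` controls the distance of `x` to `V`. -/
theorem exists_mem_norm_sub_le {T A : H →L[𝕜] H} {μ : 𝕜} {M V : Submodule 𝕜 H}
    [FiniteDimensional 𝕜 M] [FiniteDimensional 𝕜 V] (hM : ∀ x ∈ M, T x = μ • x)
    (hVA : ∀ x ∈ V, A x ∈ V) {c η κ : ℝ} (hc : 0 < c) (hη : η ≤ c / 4) (hκ : κ ≤ c / 4)
    (hκ1 : κ ≤ 1 / 2) (hcM : ∀ x, c * ‖x‖ ≤ ‖T x - μ • x + M.starProjection x‖)
    (hTA : ∀ x, ‖T x - A x‖ ≤ η * ‖x‖)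
    (hV : ∀ x ∈ V, ‖x - M.starProjection x‖ ≤ κ * ‖x‖)
    (hdim : Module.finrank 𝕜 V = Module.finrank 𝕜 M) (x : H) :
    ∃ x' ∈ V, ‖x - x'‖ ≤ 4 / c * ‖A x - μ • x‖ := by
  have hsurj := (LinearMap.injective_iff_surjective_of_finrank_eq_finrank hdim).1
    (injective_orthogonalProjectionOnto_comp_subtype (lt_of_le_of_lt hκ1 (by norm_num)) hV)
  obtain ⟨⟨x', hx'⟩, hxx'⟩ := hsurj (M.orthogonalProjectionOnto x)
  have hQ : M.starProjection x' = M.starProjection x := congrArg Subtype.val hxx'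
  refine ⟨x', hx', ?_⟩
  set y := x - x' with hy
  have hyQ : M.starProjection y = 0 := by rw [hy, map_sub, hQ, sub_self]
  set v := A x' - μ • x' with hv
  have hvV : v ∈ V := V.sub_mem (hVA _ hx') (V.smul_mem _ hx')
  set w := M.starProjection v with hw
  have hwM : w ∈ M := M.starProjection_apply_mem v
  have hQw : M.starProjection w = w := Submodule.starProjection_eq_self_iff.2 hwM
  -- `V` is invariant only under `A`, so `(A - μ) x'` leaves a residue `v`, not itself small.
  -- Testing with `y + w` instead of `y` replaces it by `v - w`, which is small since `V` is close
  -- to `M`.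
  have h1 := hcM (y + w)
  have e1 : T (y + w) - μ • (y + w) + M.starProjection (y + w) = T y - μ • y + w := by
    rw [map_add, map_add, smul_add, hM w hwM, hyQ, hQw]
    abel
  rw [e1] at h1
  have hQyw : M.starProjection (y + w) = w := by rw [map_add, hyQ, hQw, zero_add]
  have h2 : ‖w‖ ≤ ‖y + w‖ := by
    have := M.norm_starProjection_apply_le (y + w)
    rwa [hQyw] at this
  have h3 : ‖y‖ ≤ ‖y + w‖ := by
    have hwy : inner 𝕜 y w = 0 := by
      have := Submodule.sub_starProjection_mem_orthogonal (K := M) y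
      rw [hyQ, sub_zero] at this
      exact Submodule.inner_left_of_mem_orthogonal hwM this
    have := norm_add_sq_eq_norm_sq_add_norm_sq_of_inner_eq_zero y w hwy
    exact abs_le_of_sq_le_sq' (by nlinarith [sq_nonneg ‖w‖]) (norm_nonneg _) |>.2
  have h4 : ‖v - w‖ ≤ κ * ‖v‖ := hV v hvV
  have h5 : ‖v‖ ≤ ‖v - w‖ + ‖w‖ := by simpa using norm_add_le (v - w) w
  have h6 : ‖v‖ ≤ 2 * ‖w‖ := by nlinarith [norm_nonneg v]
  have h7 := hTA y
  have e2 : T y - μ • y + w = (A x - μ • x) + (T y - A y) - (v - w) := by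
    rw [hv, hy, map_sub A, smul_sub]
    abel
  have h8 : ‖T y - μ • y + w‖ ≤ ‖A x - μ • x‖ + ‖T y - A y‖ + ‖v - w‖ := by
    rw [e2]
    exact (norm_sub_le _ _).trans (add_le_add_left (norm_add_le _ _) _)
  have h9 : ‖v - w‖ ≤ c / 2 * ‖w‖ := by
    refine h4.trans ((mul_le_mul_of_nonneg_right hκ (norm_nonneg v)).trans ?_)
    nlinarith
  have h10 : η * ‖y‖ ≤ c / 4 * ‖y‖ := mul_le_mul_of_nonneg_right hη (norm_nonneg y)
  -- Of `c * ‖y + w‖`, a quarter absorbs `‖T y - A y‖` and a half absorbs `‖v - w‖`; the last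
  -- quarter gives `4 / c`.
  rw [div_mul_eq_mul_div, le_div_iff₀ hc]
  nlinarith

/-- A linear combination with small coefficients relative to a stable system is small. -/
theorem norm_sum_smul_smul_le {m : ℕ} {φ : Fin m → H} (hφ : ∀ i, ‖φ i‖ = 1) {θ ρ : ℝ}
    (hθ : 0 < θ) (hst : ∀ a : Fin m → 𝕜, θ * ∑ i, ‖a i‖ ^ 2 ≤ ‖∑ i, a i • φ i‖ ^ 2)
    (hρ : 0 ≤ ρ) {d : Fin m → 𝕜} (hd : ∀ i, ‖d i‖ ≤ ρ) (a : Fin m → 𝕜) :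
    ‖∑ i, d i • a i • φ i‖ ≤ ρ * √(m / θ) * ‖∑ i, a i • φ i‖ := by
  have h1 : ‖∑ i, d i • a i • φ i‖ ≤ ρ * ∑ i, ‖a i‖ := by
    rw [Finset.mul_sum]
    refine norm_sum_le_of_le _ fun i _ => ?_
    rw [norm_smul, norm_smul, hφ, mul_one]
    exact mul_le_mul_of_nonneg_right (hd i) (norm_nonneg _)
  have h2 : (∑ i, ‖a i‖) ^ 2 ≤ m * ∑ i, ‖a i‖ ^ 2 := by
    simpa using sq_sum_le_card_mul_sum_sq (s := Finset.univ) (f := fun i => ‖a i‖)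
  have h3 : ∑ i, ‖a i‖ ≤ √(m / θ) * ‖∑ i, a i • φ i‖ := by
    refine abs_le_of_sq_le_sq' (h2.trans ?_) (by positivity) |>.2
    rw [mul_pow, Real.sq_sqrt (by positivity), div_mul_eq_mul_div, le_div_iff₀ hθ, mul_assoc]
    refine mul_le_mul_of_nonneg_left ?_ (Nat.cast_nonneg m)
    rw [mul_comm]
    exact hst a
  rw [mul_assoc]
  exact h1.trans (mul_le_mul_of_nonneg_left h3 hρ)

theorem stabilityConstant_mul_sum_le {m : ℕ} {φ : Fin m → H} (hφ : ∀ i, ‖φ i‖ = 1)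
    (a : Fin m → 𝕜) :
    stabilityConstant 𝕜 φ * ∑ i, ‖a i‖ ^ 2 ≤ ‖∑ i, a i • φ i‖ ^ 2 := by
  rcases eq_or_ne a 0 with rfl | ha
  · simp
  have hbdd : BddBelow (Set.range fun α : {α : Fin m → 𝕜 // α ≠ 0} =>
      ‖∑ i, (α : Fin m → 𝕜) i • φ i‖ ^ 2 / ∑ i, ‖(α : Fin m → 𝕜) i • φ i‖ ^ 2) :=
    ⟨0, by rintro _ ⟨α, rfl⟩; positivity⟩
  have h1 := ciInf_le hbdd ⟨a, ha⟩
  simp only [norm_smul, hφ, mul_one] at h1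
  have hpos : 0 < ∑ i, ‖a i‖ ^ 2 := by
    obtain ⟨i, hi⟩ := Function.ne_iff.1 ha
    refine Finset.sum_pos' (fun _ _ => by positivity) ⟨i, Finset.mem_univ i, ?_⟩
    have := norm_pos_iff.2 hi
    positivity
  rw [← le_div_iff₀ hpos]
  simpa only [stabilityConstant, norm_smul, hφ, mul_one] using h1

end Perturbation

/-! ### Quasi-optimal projections and the one-sided gap -/

section QuasiOptimal

variable {𝕜 H : Type*} [RCLike 𝕜] [NormedAddCommGroup H] [InnerProductSpace 𝕜 H]

theorem Submodule.infDist_le_norm (G : Submodule 𝕜 H) (u : H) :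
    Metric.infDist u (G : Set H) ≤ ‖u‖ := by
  simpa using Metric.infDist_le_dist_of_mem (x := u) G.zero_mem

theorem IsQuasiOptimal.norm_sub_le {C₀ : ℝ} {G : Submodule 𝕜 H} {P : H →L[𝕜] H}
    (h : IsQuasiOptimal C₀ G P) (hP : LinearMap.IsProj G (P : H →ₗ[𝕜] H)) (hC₀ : 0 < C₀) (u : H) :
    ‖u - P u‖ ≤ Metric.infDist u (G : Set H) / C₀ := by
  rw [le_div_iff₀ hC₀]
  by_cases hu : u ∈ G
  · have : P u = u := hP.map_id u hu
    simp [this, Metric.infDist_nonneg]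
  · refine (Metric.le_infDist ⟨0, G.zero_mem⟩).2 fun v hv => ?_
    have hPu : 0 < ‖u - P u‖ := by
      rw [norm_pos_iff, sub_ne_zero]
      intro e
      exact hu (e ▸ hP.map_mem u)
    rw [dist_eq_norm, mul_comm, ← le_div_iff₀ hPu]
    exact h u hu v hv

/-- Uniformity over all levels matters: the final constants may see the projections only through
`C₀`. -/
theorem IsQuasiOptimal.norm_apply_le {C₀ : ℝ} {G : Submodule 𝕜 H} {P : H →L[𝕜] H}
    (h : IsQuasiOptimal C₀ G P) (hP : LinearMap.IsProj G (P : H →ₗ[𝕜] H)) (hC₀ : 0 < C₀) (u : H) :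
    ‖P u‖ ≤ (1 + 1 / C₀) * ‖u‖ := by
  have h1 := h.norm_sub_le hP hC₀ u
  have h2 : Metric.infDist u (G : Set H) / C₀ ≤ ‖u‖ / C₀ :=
    div_le_div_of_nonneg_right (G.infDist_le_norm u) hC₀.le
  have h3 : ‖P u‖ ≤ ‖u‖ + ‖u - P u‖ := by simpa using _root_.norm_sub_le u (u - P u)
  calc ‖P u‖ ≤ ‖u‖ + ‖u‖ / C₀ := by linarith
    _ = _ := by ring

theorem infDist_le_oneSidedGap {M N : Submodule 𝕜 H} {u : H} (hu : u ∈ M) (hu1 : ‖u‖ = 1) :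
    Metric.infDist u (N : Set H) ≤ oneSidedGap M N :=
  le_csSup ⟨1, by rintro _ ⟨x, ⟨-, hx⟩, rfl⟩; exact hx ▸ N.infDist_le_norm x⟩
    ⟨u, ⟨hu, hu1⟩, rfl⟩

theorem oneSidedGap_nonneg (M N : Submodule 𝕜 H) : 0 ≤ oneSidedGap M N :=
  Real.sSup_nonneg (by rintro _ ⟨x, -, rfl⟩; exact Metric.infDist_nonneg)

theorem oneSidedGap_le {M N : Submodule 𝕜 H} {a : ℝ} (ha : 0 ≤ a)
    (h : ∀ u ∈ M, ‖u‖ = 1 → Metric.infDist u (N : Set H) ≤ a) : oneSidedGap M N ≤ a :=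
  Real.sSup_le (by rintro _ ⟨x, ⟨hx, hx1⟩, rfl⟩; exact h x hx hx1) ha

end QuasiOptimal

/-! ### Error propagation from one level to the next -/

section OneLevel

variable {𝕜 H : Type*} [RCLike 𝕜] [NormedAddCommGroup H] [InnerProductSpace 𝕜 H]

/-- If `‖P T x - μ x‖` controls the distance of `x` to `V`, then unit eigenvectors of `T` are
approximated by `T V`, with an error that has the factor `‖T - T P‖`. -/
theorem exists_mem_map_norm_sub_le {T P : H →L[𝕜] H} {μ : 𝕜} (hμ : μ ≠ 0) {C₀ K : ℝ}
    (hC₀ : 0 < C₀) (hK : 0 ≤ K) {M G V : Submodule 𝕜 H} (hM : ∀ x ∈ M, T x = μ • x)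
    (hP : LinearMap.IsProj G (P : H →ₗ[𝕜] H)) (hqo : IsQuasiOptimal C₀ G P)
    (hV : ∀ x, ∃ x' ∈ V, ‖x - x'‖ ≤ K * ‖P (T x) - μ • x‖) {u : H} (hu : u ∈ M)
    (hu1 : ‖u‖ = 1) :
    ∃ x ∈ V, ‖u - μ⁻¹ • T x‖ ≤ (‖T‖ * (K * (1 + 1 / C₀)) + 1) / (‖μ‖ * C₀) *
      (‖T - T ∘L P‖ * oneSidedGap M G) := by
  obtain ⟨x, hx, hxu⟩ := hV (P u)
  refine ⟨x, hx, ?_⟩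
  have hPP (z : H) : P (P z) = P z := hP.map_id _ (hP.map_mem z)
  set f := T (P u) - μ • u with hf
  have hPf : P (T (P u)) - μ • P u = P f := by rw [hf, map_sub, map_smul]
  -- `T - T ∘L P` vanishes on the range of `P`, so `u` may be replaced by its projection error.
  have hf1 : f = -(T - T ∘L P) (u - P u) := by
    simp only [hf, sub_apply, ContinuousLinearMap.comp_apply, map_sub, hPP, hM u hu]
    abel
  have hf2 : ‖f‖ ≤ ‖T - T ∘L P‖ * oneSidedGap M G / C₀ := by
    rw [hf1, norm_neg, mul_div_assoc]
    refine (ContinuousLinearMap.le_opNorm _ _).trans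
      (mul_le_mul_of_nonneg_left ?_ (norm_nonneg _))
    exact (hqo.norm_sub_le hP hC₀ u).trans
      (div_le_div_of_nonneg_right (infDist_le_oneSidedGap hu hu1) hC₀.le)
  have he : ‖P u - x‖ ≤ K * (1 + 1 / C₀) * ‖f‖ := by
    rw [hPf] at hxu
    rw [mul_assoc]
    exact hxu.trans (mul_le_mul_of_nonneg_left (hqo.norm_apply_le hP hC₀ f) hK)
  have hμu : u - μ⁻¹ • T x = μ⁻¹ • (T (P u - x) - f) := by
    rw [hf, map_sub, smul_sub, smul_sub, smul_sub, smul_smul, inv_mul_cancel₀ hμ, one_smul]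
    abel
  have hμ' : 0 < ‖μ‖ := norm_pos_iff.2 hμ
  have h1 : ‖T (P u - x) - f‖ ≤ (‖T‖ * (K * (1 + 1 / C₀)) + 1) * ‖f‖ := by
    refine (norm_sub_le _ _).trans ?_
    have h2 := T.le_opNorm (P u - x)
    have h3 := mul_le_mul_of_nonneg_left he (norm_nonneg T)
    linarith
  rw [hμu, norm_smul, norm_inv, inv_mul_le_iff₀ hμ']
  calc _ ≤ (‖T‖ * (K * (1 + 1 / C₀)) + 1) * ‖f‖ := h1
    _ ≤ (‖T‖ * (K * (1 + 1 / C₀)) + 1) * (‖T - T ∘L P‖ * oneSidedGap M G / C₀) := by gcongr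
    _ = _ := by field_simp

/-- The gap to a space that contains `P T V`, where `P` is a quasi-optimal projection onto `G`
and `T V` approximates the unit vectors of `M`. -/
theorem oneSidedGap_le_add {T P : H →L[𝕜] H} {C₀ b : ℝ} (hC₀ : 0 < C₀) (hb : 0 ≤ b)
    {M G G' V : Submodule 𝕜 H} (hP : LinearMap.IsProj G (P : H →ₗ[𝕜] H))
    (hqo : IsQuasiOptimal C₀ G P) (hG' : ∀ x ∈ V, P (T x) ∈ G') {μ : 𝕜}
    (hV : ∀ u ∈ M, ‖u‖ = 1 → ∃ x ∈ V, ‖u - μ⁻¹ • T x‖ ≤ b) :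
    oneSidedGap M G' ≤ (1 + 1 / C₀) * oneSidedGap M G + (1 + 1 / C₀) * b := by
  have hG := oneSidedGap_nonneg M G
  refine oneSidedGap_le (by positivity) fun u hu hu1 => ?_
  obtain ⟨x, hx, hux⟩ := hV u hu hu1
  have h1 : ‖u - P u‖ ≤ (1 + 1 / C₀) * oneSidedGap M G := by
    refine (hqo.norm_sub_le hP hC₀ u).trans ?_
    rw [div_eq_mul_one_div, mul_comm]
    refine mul_le_mul ?_ (infDist_le_oneSidedGap hu hu1) Metric.infDist_nonneg (by positivity)
    linarith
  have h2 : ‖P (u - μ⁻¹ • T x)‖ ≤ (1 + 1 / C₀) * b :=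
    (hqo.norm_apply_le hP hC₀ _).trans (mul_le_mul_of_nonneg_left hux (by positivity))
  have h3 : P (μ⁻¹ • T x) ∈ G' := by
    rw [map_smul]
    exact G'.smul_mem _ (hG' x hx)
  calc Metric.infDist u (G' : Set H) ≤ dist u (P (μ⁻¹ • T x)) := Metric.infDist_le_dist_of_mem h3
    _ = ‖(u - P u) + P (u - μ⁻¹ • T x)‖ := by
      rw [dist_eq_norm, map_sub]
      congr 1
      abel
    _ ≤ _ := (norm_add_le _ _).trans (add_le_add h1 h2)

/-- Solution of the recursion `d (l + 1) ≤ a g (l + 1) + t l d l`. -/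
theorem le_mul_sum_prod_of_recursion {N : ℕ} {a : ℝ} {d g t : ℕ → ℝ} (ht : ∀ l, 0 ≤ t l)
    (h0 : d 0 ≤ a * g 0) (hstep : ∀ l < N, d (l + 1) ≤ a * g (l + 1) + t l * d l) :
    d N ≤ a * ∑ l ∈ Finset.range (N + 1), (∏ j ∈ Finset.Ico l N, t j) * g l := by
  induction N with
  | zero => simpa using h0
  | succ N ih =>
    have ih' := ih fun l hl => hstep l (hl.trans N.lt_succ_self)
    have h1 : ∑ l ∈ Finset.range (N + 1), (∏ j ∈ Finset.Ico l (N + 1), t j) * g l =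
        t N * ∑ l ∈ Finset.range (N + 1), (∏ j ∈ Finset.Ico l N, t j) * g l := by
      rw [Finset.mul_sum]
      refine Finset.sum_congr rfl fun l hl => ?_
      rw [Finset.prod_Ico_succ_top (Nat.lt_succ_iff.1 (Finset.mem_range.1 hl))]
      ring
    rw [Finset.sum_range_succ, h1, Finset.Ico_self, Finset.prod_empty, one_mul]
    have h2 := mul_le_mul_of_nonneg_left ih' (ht N)
    have h3 := hstep N N.lt_succ_self
    linarith

end OneLevel

/-! ### The span of the computed eigenvectors -/

section Eigenvectors

variable {𝕜 H : Type*} [RCLike 𝕜] [NormedAddCommGroup H] [InnerProductSpace 𝕜 H]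

open Module

/-- Let `μ` be an eigenvalue of `T` whose algebraic multiplicity is the number of the
eigenvectors `φ` of `A`, which are stable and have eigenvalues near `μ`.
If `A` is close to `T`, then `μ` is semisimple and `‖A x - μ x‖` controls the distance of `x` to
the span of `φ`. -/
theorem exists_mem_span_norm_sub_le {T A : H →L[𝕜] H} {μ : 𝕜} {m : ℕ} {E : Submodule 𝕜 H}
    [FiniteDimensional 𝕜 E] (hm : finrank 𝕜 E = m) {M : Submodule 𝕜 H} [FiniteDimensional 𝕜 M]
    (hME : M ≤ E) (hM : ∀ x ∈ M, T x = μ • x) {c c₁ θ η ρ κ : ℝ} (hc : 0 < c) (hc₁ : 0 < c₁)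
    (hθ : 0 < θ) (hρ : 0 ≤ ρ)
    (hcM : ∀ y ∈ Mᗮ, c * ‖y‖ ≤ ‖T y - μ • y‖)
    (hcB : M = E → ∀ x, c₁ * ‖x‖ ≤ ‖T x - μ • x + M.starProjection x‖)
    (hTA : ∀ x, ‖T x - A x‖ ≤ η * ‖x‖) (hη₁ : η ≤ c₁ / 4)
    (hκ : η + ρ * √(m / θ) ≤ κ * c) (hκ1 : κ ≤ 1 / 2) (hκ₁ : κ ≤ c₁ / 4)
    {φ : Fin m → H} {lam : Fin m → 𝕜} (hφ : ∀ i, ‖φ i‖ = 1) (hφA : ∀ i, A (φ i) = lam i • φ i)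
    (hli : LinearIndependent 𝕜 φ) (hst : θ ≤ stabilityConstant 𝕜 φ)
    (hlam : ∀ i, ‖lam i - μ‖ ≤ ρ) (x : H) :
    ∃ x' ∈ Submodule.span 𝕜 (Set.range φ), ‖x - x'‖ ≤ 4 / c₁ * ‖A x - μ • x‖ := by
  set V := Submodule.span 𝕜 (Set.range φ) with hVdef
  have : FiniteDimensional 𝕜 V := FiniteDimensional.span_of_finite 𝕜 (Set.finite_range φ)
  have hVdim : finrank 𝕜 V = m := by rw [hVdef, finrank_span_eq_card hli, Fintype.card_fin]
  have hst' (a : Fin m → 𝕜) : θ * ∑ i, ‖a i‖ ^ 2 ≤ ‖∑ i, a i • φ i‖ ^ 2 :=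
    (mul_le_mul_of_nonneg_right hst (by positivity)).trans (stabilityConstant_mul_sum_le hφ a)
  have hV (z : H) (hz : z ∈ V) : ‖T z - μ • z‖ ≤ (κ * c) * ‖z‖ := by
    obtain ⟨a, rfl⟩ := (Submodule.mem_span_range_iff_exists_fun 𝕜).1 hz
    have h1 := norm_sum_smul_smul_le hφ hθ hst' hρ hlam a
    have h2 : A (∑ i, a i • φ i) - μ • ∑ i, a i • φ i = ∑ i, (lam i - μ) • a i • φ i := by
      rw [map_sum, Finset.smul_sum, ← Finset.sum_sub_distrib]
      refine Finset.sum_congr rfl fun i _ => ?_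
      rw [map_smul, hφA, sub_smul, smul_comm (a i)]
    rw [← h2] at h1
    have h3 := hTA (∑ i, a i • φ i)
    have h4 := norm_add_le (T (∑ i, a i • φ i) - A (∑ i, a i • φ i))
      (A (∑ i, a i • φ i) - μ • ∑ i, a i • φ i)
    rw [sub_add_sub_cancel] at h4
    refine h4.trans ((add_le_add h3 h1).trans ?_)
    rw [← add_mul]
    exact mul_le_mul_of_nonneg_right hκ (norm_nonneg _)
  have hVQ (z : H) (hz : z ∈ V) : ‖z - M.starProjection z‖ ≤ κ * ‖z‖ := by
    have := norm_sub_starProjection_le hM hc hcM hV hz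
    rwa [mul_div_assoc, div_self hc.ne', mul_one] at this
  have hVM : finrank 𝕜 V ≤ finrank 𝕜 M :=
    LinearMap.finrank_le_finrank_of_injective
      (injective_orthogonalProjectionOnto_comp_subtype (lt_of_le_of_lt hκ1 (by norm_num)) hVQ)
  -- Semisimplicity is derived here; only now does `hcB` become available.
  have hEq : M = E := Submodule.eq_of_le_of_finrank_le hME (by rw [hm, ← hVdim]; exact hVM)
  have hVA : ∀ z ∈ V, A z ∈ V := by
    intro z hz
    have : V ≤ V.comap (A : H →ₗ[𝕜] H) := by
      refine Submodule.span_le.2 ?_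
      rintro _ ⟨i, rfl⟩
      change A (φ i) ∈ V
      rw [hφA]
      exact V.smul_mem _ (Submodule.subset_span ⟨i, rfl⟩)
    exact this hz
  refine exists_mem_norm_sub_le hM hVA hc₁ hη₁ hκ₁ hκ1 (hcB hEq) hTA hVQ ?_ x
  rw [hEq, hm, hVdim]

end Eigenvectors

/-! ### Consequences of the algorithm's definition -/

section MultilevelRun

variable {𝕜 H : Type*} [RCLike 𝕜] [NormedAddCommGroup H] [InnerProductSpace 𝕜 H]

theorem IsMultilevelRun.le_aux {T : H →L[𝕜] H} {N k : ℕ} {G : ℕ → Submodule 𝕜 H}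
    {P : ℕ → H →L[𝕜] H} {Gt : ℕ → Submodule 𝕜 H} {Pt : ℕ → H →L[𝕜] H}
    {lam : ℕ → Fin k → 𝕜} {v : ℕ → Fin k → H} (h : IsMultilevelRun T N k G P Gt Pt lam v)
    {l : ℕ} (hl : l ≤ N) : G 0 ≤ Gt l := by
  cases l with
  | zero => exact h.aux_zero.ge
  | succ l => exact (h.aux_succ l hl).symm ▸ le_sup_left

/-- `P T` maps the computed eigenvectors of a level to the auxiliary space of the next one. -/
theorem IsMultilevelRun.apply_mem_aux {T : H →L[𝕜] H} {N k : ℕ} {G : ℕ → Submodule 𝕜 H}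
    {P : ℕ → H →L[𝕜] H} {Gt : ℕ → Submodule 𝕜 H} {Pt : ℕ → H →L[𝕜] H}
    {lam : ℕ → Fin k → 𝕜} {v : ℕ → Fin k → H} (h : IsMultilevelRun T N k G P Gt Pt lam v)
    {l : ℕ} (hl : l < N) (j : Fin k) : P (l + 1) (T (v l j)) ∈ Gt (l + 1) := by
  have h1 : (lam l j)⁻¹ • P (l + 1) (T (v l j)) ∈ Gt (l + 1) := by
    rw [h.aux_succ l hl]
    exact Submodule.mem_sup_right (Submodule.subset_span ⟨j, rfl⟩)
  have h2 := (Gt (l + 1)).smul_mem (lam l j) h1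
  rwa [smul_smul, mul_inv_cancel₀ ((h.eigenpairs l hl.le).ne_zero j), one_smul] at h2

/-- `P T` is close to `T` if `P` is a quasi-optimal projection onto a space that contains a good
approximation space of the range of `T`. -/
theorem IsQuasiOptimal.norm_apply_sub_le {T P : H →L[𝕜] H} {C₀ ε : ℝ} {G₀ G : Submodule 𝕜 H}
    (h : IsQuasiOptimal C₀ G P) (hP : LinearMap.IsProj G (P : H →ₗ[𝕜] H)) (hC₀ : 0 < C₀)
    (hG : G₀ ≤ G) (hε : ∀ x, Metric.infDist (T x) (G₀ : Set H) ≤ ε * ‖x‖) (x : H) :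
    ‖T x - (P ∘L T) x‖ ≤ ε / C₀ * ‖x‖ := by
  refine (h.norm_sub_le hP hC₀ (T x)).trans ?_
  rw [div_mul_eq_mul_div]
  exact div_le_div_of_nonneg_right
    ((Metric.infDist_le_infDist_of_subset hG ⟨0, G₀.zero_mem⟩).trans (hε x)) hC₀.le

end MultilevelRun

/-! ### Choice of constants and assembly -/

theorem mainTheorem5 {𝕜 H : Type*} [RCLike 𝕜] [NormedAddCommGroup H] [InnerProductSpace 𝕜 H]
    [CompleteSpace H] (T : H →L[𝕜] H) (hT : IsCompactOperator T)
    (μ : 𝕜) (hμ0 : μ ≠ 0) (hμ : Module.End.HasEigenvalue (T : H →ₗ[𝕜] H) μ)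
    -- `m` is the algebraic multiplicity of `μ`
    (m : ℕ) (hm : Module.finrank 𝕜 (Module.End.maxGenEigenspace (T : H →ₗ[𝕜] H) μ) = m)
    (C₀ θ₀ : ℝ) (hC₀ : 0 < C₀) (hθ₀ : 0 < θ₀) :
    ∃ β₁ β₂ : ℝ, 0 < β₁ ∧ 0 < β₂ ∧
      -- `r` is the radius of a circle around `μ` that encloses no other point of the spectrum
      ∀ r : ℝ, 0 < r → spectrum 𝕜 T ∩ Metric.closedBall μ r = {μ} →
      -- `ε` says how big `G 0` has to be
      ∃ ε : ℝ, 0 < ε ∧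
        ∀ (N k : ℕ) (G : ℕ → Submodule 𝕜 H) (P : ℕ → H →L[𝕜] H)
          (Gt : ℕ → Submodule 𝕜 H) (Pt : ℕ → H →L[𝕜] H)
          (lam : ℕ → Fin k → 𝕜) (v : ℕ → Fin k → H)
          -- `s l` selects the `m` computed eigenpairs of level `l` that approximate `μ`
          (s : ℕ → Fin m ↪ Fin k),
          IsMultilevelRun T N k G P Gt Pt lam v →
          (∀ x : H, Metric.infDist (T x) (G 0 : Set H) ≤ ε * ‖x‖) →
          (∀ l, 1 ≤ l → l ≤ N → IsQuasiOptimal C₀ (G l) (P l)) →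
          (∀ l < N, IsQuasiOptimal C₀ (Gt l) (Pt l)) →
          (∀ l < N, ∀ j, lam l (s l j) ∈ Metric.ball μ r) →
          (∀ l < N, θ₀ ≤ stabilityConstant 𝕜 (fun j => v l (s l j))) →
          oneSidedGap (Module.End.eigenspace (T : H →ₗ[𝕜] H) μ) (Gt N) ≤
            β₁ * ∑ l ∈ Finset.range (N + 1),
              (∏ j ∈ Finset.Ico l N, (β₂ * ‖T - T ∘L Pt j‖)) *
                oneSidedGap (Module.End.eigenspace (T : H →ₗ[𝕜] H) μ) (G l) := by
  set M := Module.End.eigenspace (T : H →ₗ[𝕜] H) μ with hMdef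
  set E := Module.End.maxGenEigenspace (T : H →ₗ[𝕜] H) μ with hEdef
  have hMT (x : H) (hx : x ∈ M) : T x = μ • x := Module.End.mem_eigenspace_iff.1 hx
  have hME : M ≤ E := Module.End.eigenspace_le_maxGenEigenspace
  have hE : FiniteDimensional 𝕜 E := hT.finiteDimensional_maxGenEigenspace hμ0
  have hM : FiniteDimensional 𝕜 M := Submodule.finiteDimensional_of_le hME
  obtain ⟨c, hc, hcM⟩ := hT.exists_mul_norm_le_of_mem_orthogonal hμ0
  -- `β₂` needs `c₁` before any run is given, so a dummy value `1` serves when `μ` is not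
  -- semisimple.
  obtain ⟨c₁, hc₁, hcB⟩ : ∃ c₁ > 0, M = E →
      ∀ x, c₁ * ‖x‖ ≤ ‖T x - μ • x + M.starProjection x‖ := by
    by_cases h : M = E
    · obtain ⟨c₁, hc₁, hcB⟩ := hT.exists_mul_norm_le_add_starProjection hμ0 h
      exact ⟨c₁, hc₁, fun _ => hcB⟩
    · exact ⟨1, one_pos, fun h' => absurd h' h⟩
  have hμn : 0 < ‖μ‖ := norm_pos_iff.2 hμ0
  set β := (‖T‖ * (4 / c₁ * (1 + 1 / C₀)) + 1) / (‖μ‖ * C₀) with hβ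
  have hβ0 : 0 < β := by positivity
  refine ⟨1 + 1 / C₀, (1 + 1 / C₀) * β, by positivity, by positivity, fun r hr hspec => ?_⟩
  set κ := min (1 / 2) (c₁ / 4) with hκ
  have hκ0 : 0 < κ := by positivity
  -- The eigenvalue errors get half of the budget `κ * c`; the operator error `η` gets the other
  -- half.
  set ρ := κ * c / (2 * (√(m / θ₀) + 1)) with hρ
  have hρ0 : 0 < ρ := by positivity
  have hρκ : ρ * √(m / θ₀) ≤ κ * c / 2 := by
    rw [hρ, div_mul_eq_mul_div, div_le_div_iff₀ (by positivity) two_pos]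
    nlinarith [mul_pos hκ0 hc, Real.sqrt_nonneg (m / θ₀)]
  -- The only constant that depends on `r`; it enters `η`, hence `ε`, but neither `β₁` nor `β₂`.
  obtain ⟨c₂, hc₂, hcR⟩ := T.exists_mul_norm_le_of_isCompact
    (K := Metric.closedBall μ r \ Metric.ball μ ρ)
    ((isCompact_closedBall μ r).diff Metric.isOpen_ball) fun z hz hzT => by
      have : z ∈ ({μ} : Set 𝕜) := hspec ▸ ⟨hzT, hz.1⟩
      rw [Set.mem_singleton_iff.1 this] at hz
      exact hz.2 (Metric.mem_ball_self hρ0)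
  set η := min (κ * c / 2) (min (c₁ / 4) (c₂ / 2)) with hη
  have hη0 : 0 < η := by positivity
  -- The factor `C₀` offsets the loss `1 / C₀` of quasi-optimality.
  refine ⟨η * C₀, by positivity, fun N k G P Gt Pt lam v s hrun hG0 hqP hqPt hball hθ => ?_⟩
  refine le_mul_sum_prod_of_recursion (d := fun l => oneSidedGap M (Gt l))
    (g := fun l => oneSidedGap M (G l)) (fun l => by positivity) ?_ fun l hl => ?_
  · rw [hrun.aux_zero]
    exact le_mul_of_one_le_left (oneSidedGap_nonneg _ _) (le_add_of_nonneg_right (by positivity))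
  have hproj := hrun.aux_proj l hl.le
  have hep := hrun.eigenpairs l hl.le
  have hTA (x : H) : ‖T x - (Pt l ∘L T) x‖ ≤ η * ‖x‖ := by
    have := (hqPt l hl).norm_apply_sub_le hproj hC₀ (hrun.le_aux hl.le) hG0 x
    rwa [mul_div_assoc, div_self hC₀.ne', mul_one] at this
  have hlam (j : Fin m) : ‖lam l (s l j) - μ‖ ≤ ρ := by
    -- Otherwise the eigenvalue lies in the annulus, where a unit eigenvector of `Pt l ∘L T` gives
    -- `c₂ ≤ η ≤ c₂ / 2`.
    by_contra! hgt
    have h1 := hcR (lam l (s l j)) ⟨Metric.ball_subset_closedBall (hball l hl j), fun h => by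
      rw [Metric.mem_ball, dist_eq_norm] at h
      exact hgt.not_gt h⟩ (v l (s l j))
    have h2 := hTA (v l (s l j))
    rw [hep.eigen] at h2
    rw [hep.norm_eq_one] at h1 h2
    have h3 : η ≤ c₂ / 2 := (min_le_right _ _).trans (min_le_right _ _)
    linarith
  have hV := exists_mem_span_norm_sub_le (T := T) (A := Pt l ∘L T) hm hME hMT hc hc₁ hθ₀ hρ0.le
    hcM hcB hTA ((min_le_right _ _).trans (min_le_left _ _))
    (by linarith [min_le_left (κ * c / 2) (min (c₁ / 4) (c₂ / 2))]) (min_le_left _ _)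
    (min_le_right _ _) (φ := fun j => v l (s l j)) (lam := fun j => lam l (s l j))
    (fun j => hep.norm_eq_one _) (fun j => hep.eigen _)
    (hep.linearIndependent.comp _ (s l).injective) (hθ l hl) hlam
  have hmem (x : H) (hx : x ∈ Submodule.span 𝕜 (Set.range fun j => v l (s l j))) :
      P (l + 1) (T x) ∈ Gt (l + 1) := by
    have : Submodule.span 𝕜 (Set.range fun j => v l (s l j)) ≤
        (Gt (l + 1)).comap (P (l + 1) ∘L T : H →ₗ[𝕜] H) := by
      refine Submodule.span_le.2 ?_
      rintro _ ⟨j, rfl⟩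
      exact hrun.apply_mem_aux hl _
    exact this hx
  have hgap := oneSidedGap_nonneg M (Gt l)
  have hstep := oneSidedGap_le_add (b := β * (‖T - T ∘L Pt l‖ * oneSidedGap M (Gt l))) hC₀
    (by positivity) (hrun.proj (l + 1) l.succ_pos hl) (hqP (l + 1) l.succ_pos hl) hmem
    fun u hu hu1 => exists_mem_map_norm_sub_le hμ0 hC₀ (by positivity) hMT hproj (hqPt l hl) hV
      hu hu1
  refine hstep.trans_eq ?_
  ring
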